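/- Let $a\in\mathbb R$ and $L>0$. Consider the boundary value problem $$u'''+au'-u^2u'=0\ \text{ on } [0,L],\qquad u(0)=u(L)=u'(L)=0,$$ for real-valued $u\in C^3[0,L]$ (one-sided derivatives at the endpoints). Since $u(0)=u(L)$, a solution extends to an $L$-periodic function on $\mathbb R$. The fundamental period of $u$ is the smallest positive period of this extension. If $aL^2>4\pi^2$, then there exists a nontrivial (not identically zero on $[0,L]$) solution $u$ of this problem with fundamental period $L$, and it is unique up to sign: the nontrivial solutions with fundamental period $L$ are exactly $u$ and $-u$. If $aL^2\le 4\pi^2$, then the problem has no nontrivial solution with fundamental period $L$. -/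

import Mathlib

/-- `u ∈ C³[0, L]` is a classical solution on `[0, L]` of the boundary value problem
`u''' + a u' - u² u' = 0`, `u(0) = u(L) = u'(L) = 0`
(derivatives at the endpoints are one-sided).
Only the values of `u` on `[0, L]` matter. -/
structure IsStationarySolution (a L : ℝ) (u : ℝ → ℝ) : Prop where
  contDiffOn : ContDiffOn ℝ 3 u (Set.Icc 0 L)
  equation : ∀ x ∈ Set.Icc 0 L,
    iteratedDerivWithin 3 u (Set.Icc 0 L) x + a * derivWithin u (Set.Icc 0 L) x
      - u x ^ 2 * derivWithin u (Set.Icc 0 L) x = 0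
  left_value : u 0 = 0
  right_value : u L = 0
  right_deriv : derivWithin u (Set.Icc 0 L) L = 0

/-- The `L`-periodic function on `ℝ` that agrees with `u` on `[0, L)`, for `0 < L`
(hence on `[0, L]` when `u 0 = u L`). -/
noncomputable def periodicExtension (L : ℝ) (u : ℝ → ℝ) : ℝ → ℝ :=
  fun x => u (L * Int.fract (x / L))

/-- `T` is the fundamental period of `f`: the smallest positive period. -/
def IsFundamentalPeriod (f : ℝ → ℝ) (T : ℝ) : Prop :=
  IsLeast {S : ℝ | 0 < S ∧ Function.Periodic f S} T

/-- `u` is a nontrivial solution of the boundary value problem on `[0, L]` whose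
(periodically extended) fundamental period is `T`. -/
structure IsNontrivialSolutionWithPeriod (a L T : ℝ) (u : ℝ → ℝ) : Prop where
  solution : IsStationarySolution a L u
  nontrivial : ∃ x ∈ Set.Icc 0 L, u x ≠ 0
  fundamentalPeriod : IsFundamentalPeriod (periodicExtension L u) T

/-! The equation is a total derivative: `v'' + a v - v³/3 = b` for some constant `b`. A second
integration, with `v = v' = 0` at `L`, gives `v'² = v (2b - a v + v³/6)`, hence also `v' = 0` at
`0`. Up to sign `b > 0`, since `b = 0` leaves only `v = 0` by ODE uniqueness. If `r` is the maximum
of `v`, then `2b = a r - r³/6` and `v'² = v (r - v) (a - (r² + r v + v²)/6)`, which forces `r² <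
2a`. Writing `v = r (1 - cos θ)/2` turns this into `θ'² = speedSq a (r²) θ`, where the right side
never vanishes. So `v` starts at rest from `0` and has period `wavePeriod a (r²)`.

This period is strictly increasing in `k = r²` (`wavePeriod_lt`), equals `2π/√a` at `k = 0`, and is
unbounded as `k → 2a` (`wavePeriod_lower`). Hence `L` is attained, by exactly one amplitude,
precisely when `L > 2π/√a`, that is, `a L² > 4π²`. The wave comes from `exists_wave`; that every
solution is one, up to sign, comes from `IsNontrivialSolutionWithPeriod.exists_amplitude` and
`IsOscillation.eqOn_of_left`. -/

/-! ### The period as a function of the squared amplitude. -/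

/-- Squared angular speed `a - k (1 + s + s²) / 6`, `s = (1 - cos θ) / 2`, of a periodic wave of
squared amplitude `k` written as `√k * s`. -/
noncomputable def speedSq (a k θ : ℝ) : ℝ :=
  a - k * (1 + (1 - Real.cos θ) / 2 + ((1 - Real.cos θ) / 2) ^ 2) / 6

/-- Time needed to reach the angle `θ`. -/
noncomputable def travelTime (a k θ : ℝ) : ℝ :=
  ∫ φ in (0 : ℝ)..θ, (Real.sqrt (speedSq a k φ))⁻¹

/-- Period of the wave of squared amplitude `k`. -/
noncomputable def wavePeriod (a k : ℝ) : ℝ := travelTime a k (2 * Real.pi)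

lemma speedSq_lower {a k : ℝ} (hk : 0 ≤ k) (θ : ℝ) : a - k / 2 ≤ speedSq a k θ := by
  unfold speedSq
  have h1 := Real.cos_le_one θ
  have h2 := Real.neg_one_le_cos θ
  have : (1 + (1 - Real.cos θ) / 2 + ((1 - Real.cos θ) / 2) ^ 2) ≤ 3 := by nlinarith
  nlinarith

lemma speedSq_pos {a k : ℝ} (hk : 0 ≤ k) (hka : k < 2 * a) (θ : ℝ) : 0 < speedSq a k θ :=
  lt_of_lt_of_le (by linarith) (speedSq_lower hk θ)

lemma speedSq_strictAnti {a k l : ℝ} (hkl : k < l) (θ : ℝ) : speedSq a l θ < speedSq a k θ := by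
  unfold speedSq
  have h1 := Real.cos_le_one θ
  have : 0 < (1 + (1 - Real.cos θ) / 2 + ((1 - Real.cos θ) / 2) ^ 2) := by nlinarith
  nlinarith

lemma continuous_speedSq (a k : ℝ) : Continuous (speedSq a k) := by
  unfold speedSq; fun_prop

lemma speedSq_periodic (a k : ℝ) : Function.Periodic (speedSq a k) (2 * Real.pi) := by
  intro θ; simp [speedSq]

lemma continuous_inv_speed {a k : ℝ} (hk : 0 ≤ k) (hka : k < 2 * a) :
    Continuous fun φ => (Real.sqrt (speedSq a k φ))⁻¹ :=
  (continuous_speedSq a k).sqrt.inv₀ fun φ => (Real.sqrt_pos.2 (speedSq_pos hk hka φ)).ne'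

lemma wavePeriod_zero (a : ℝ) : wavePeriod a 0 = 2 * Real.pi / Real.sqrt a := by
  simp [wavePeriod, travelTime, speedSq, div_eq_mul_inv]

lemma wavePeriod_lt {a k l : ℝ} (hk : 0 ≤ k) (hkl : k < l) (hla : l < 2 * a) :
    wavePeriod a k < wavePeriod a l := by
  have hpos : (0 : ℝ) < 2 * Real.pi := by positivity
  have key : ∀ φ, (Real.sqrt (speedSq a k φ))⁻¹ < (Real.sqrt (speedSq a l φ))⁻¹ := fun φ => by
    have := speedSq_pos (hk.trans hkl.le) hla φ
    exact inv_strictAnti₀ (Real.sqrt_pos.2 this)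
      (Real.sqrt_lt_sqrt this.le (speedSq_strictAnti hkl φ))
  exact intervalIntegral.integral_lt_integral_of_continuousOn_of_le_of_exists_lt hpos
    (continuous_inv_speed hk (hkl.trans hla)).continuousOn
    (continuous_inv_speed (hk.trans hkl.le) hla).continuousOn (fun φ _ => (key φ).le)
    ⟨0, ⟨le_rfl, hpos.le⟩, key 0⟩

lemma wavePeriod_injOn (a : ℝ) : Set.InjOn (wavePeriod a) (Set.Ico 0 (2 * a)) := by
  refine StrictMonoOn.injOn ?_
  intro k hk l hl h
  exact wavePeriod_lt hk.1 h hl.2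

lemma continuousOn_wavePeriod {a k₁ : ℝ} (hka : k₁ < 2 * a) :
    ContinuousOn (wavePeriod a) (Set.Icc 0 k₁) := by
  have hδ : 0 < a - k₁ / 2 := by linarith
  -- Truncating the squared speed from below makes the integrand continuous for all `k`; on `[0,
  -- k₁]` the truncation changes nothing.
  have hc : Continuous fun k => ∫ φ in (0 : ℝ)..(2 * Real.pi),
      (Real.sqrt (max (speedSq a k φ) (a - k₁ / 2)))⁻¹ := by
    apply intervalIntegral.continuous_parametric_intervalIntegral_of_continuous'
    apply Continuous.inv₀
    · simp only [speedSq]; fun_prop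
    · intro p
      exact (Real.sqrt_pos.2 (lt_max_of_lt_right hδ)).ne'
  refine hc.continuousOn.congr ?_
  intro k hk
  unfold wavePeriod travelTime
  congr 1
  ext φ
  rw [max_eq_left]
  have := speedSq_lower (a := a) hk.1 φ
  linarith [hk.2]

/-- At `k = 2a` the speed vanishes at `θ = π`. With `k = 2a(1 - δ²)`, the bound `cos x ≥ 1 - x²/2`
yields a squared speed at `π + x` of at most `a (δ² + x²/4) ≤ a (δ + x/2)²`. -/
lemma inv_speed_lower {a δ : ℝ} (hδ : 0 < δ) (hδ1 : δ < 1) (ha : 0 < a) (x : ℝ) (hx : 0 ≤ x) :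
    (Real.sqrt a)⁻¹ * (δ + x / 2)⁻¹ ≤
      (Real.sqrt (speedSq a (2 * a * (1 - δ ^ 2)) (Real.pi + x)))⁻¹ := by
  have h2 : 2 * a * (1 - δ ^ 2) < 2 * a := by nlinarith [mul_pos ha (pow_pos hδ 2)]
  have h0 : 0 ≤ 2 * a * (1 - δ ^ 2) := by
    have : δ ^ 2 < 1 := by nlinarith
    nlinarith
  have hp := speedSq_pos h0 h2 (Real.pi + x)
  rw [← mul_inv]
  apply inv_anti₀ (Real.sqrt_pos.2 hp)
  rw [Real.sqrt_le_iff]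
  refine ⟨by positivity, ?_⟩
  rw [mul_pow, Real.sq_sqrt ha.le]
  have hcos : 1 - x ^ 2 / 2 ≤ Real.cos x := Real.one_sub_sq_div_two_le_cos
  unfold speedSq
  rw [add_comm Real.pi x, Real.cos_add_pi]
  set c := Real.cos x with hc
  have h1 : c ≤ 1 := Real.cos_le_one x
  have h3 : -1 ≤ c := Real.neg_one_le_cos x
  have e : a - 2 * a * (1 - δ ^ 2) * (1 + (1 - -c) / 2 + ((1 - -c) / 2) ^ 2) / 6 =
      a * (1 - (1 - δ ^ 2) * (1 + (1 + c) / 2 + ((1 + c) / 2) ^ 2) / 3) := by ring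
  rw [e]
  apply mul_le_mul_of_nonneg_left _ ha.le
  have hq : (1 + (1 + c) / 2 + ((1 + c) / 2) ^ 2) ≤ 3 := by nlinarith
  have hq2 : 3 - 3 * ((1 - c) / 2) ≤ (1 + (1 + c) / 2 + ((1 + c) / 2) ^ 2) := by
    nlinarith [sq_nonneg (1 - c)]
  nlinarith [mul_nonneg hδ.le hx, mul_nonneg (sq_nonneg δ) (sub_nonneg.2 hq)]

lemma integral_inv_add_half {δ : ℝ} (hδ : 0 < δ) :
    ∫ x in (0 : ℝ)..Real.pi, (δ + x / 2)⁻¹ =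
      2 * Real.log (δ + Real.pi / 2) - 2 * Real.log δ := by
  have hne : ∀ x ∈ Set.uIcc 0 Real.pi, δ + x / 2 ≠ 0 := by
    intro x hx
    rw [Set.uIcc_of_le Real.pi_pos.le] at hx
    have := hx.1
    positivity
  rw [intervalIntegral.integral_eq_sub_of_hasDerivAt
    (f := fun x => 2 * Real.log (δ + x / 2))]
  · simp
  · intro x hx
    have h : HasDerivAt (fun x : ℝ => δ + x / 2) (1 / 2) x :=
      ((hasDerivAt_id x).div_const 2).const_add δ
    convert! (h.log (hne x hx)).const_mul 2 using 1
    ring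
  · apply ContinuousOn.intervalIntegrable
    exact ContinuousOn.inv₀ (by fun_prop) hne

/-- Logarithmic divergence at the homoclinic limit `δ → 0`: only the half turn `[π, 2π]` is kept,
and the nonnegative term `log (δ + π/2)` is dropped. -/
lemma wavePeriod_lower {a δ : ℝ} (hδ : 0 < δ) (hδ1 : δ < 1) (ha : 0 < a) :
    (Real.sqrt a)⁻¹ * (-2 * Real.log δ) ≤ wavePeriod a (2 * a * (1 - δ ^ 2)) := by
  have h2 : 2 * a * (1 - δ ^ 2) < 2 * a := by nlinarith [mul_pos ha (pow_pos hδ 2)]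
  have h0 : 0 ≤ 2 * a * (1 - δ ^ 2) := by
    have : δ ^ 2 < 1 := by nlinarith
    nlinarith
  have hcont := continuous_inv_speed h0 h2
  have hpi := Real.pi_pos
  calc (Real.sqrt a)⁻¹ * (-2 * Real.log δ)
      ≤ (Real.sqrt a)⁻¹ * (2 * Real.log (δ + Real.pi / 2) - 2 * Real.log δ) := by
        have : 0 ≤ Real.log (δ + Real.pi / 2) :=
          Real.log_nonneg (by linarith [Real.two_le_pi])
        gcongr
        linarith
    _ = ∫ x in (0 : ℝ)..Real.pi, (Real.sqrt a)⁻¹ * (δ + x / 2)⁻¹ := by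
        rw [intervalIntegral.integral_const_mul, integral_inv_add_half hδ]
    _ ≤ ∫ x in (0 : ℝ)..Real.pi,
          (Real.sqrt (speedSq a (2 * a * (1 - δ ^ 2)) (Real.pi + x)))⁻¹ := by
        apply intervalIntegral.integral_mono_on hpi.le
        · apply ContinuousOn.intervalIntegrable
          refine ContinuousOn.mul continuousOn_const (ContinuousOn.inv₀ (by fun_prop) ?_)
          intro x hx
          rw [Set.uIcc_of_le hpi.le] at hx
          have := hx.1
          positivity
        · exact (hcont.comp (continuous_const.add continuous_id)).intervalIntegrable _ _
        · intro x hx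
          exact inv_speed_lower hδ hδ1 ha x hx.1
    _ = ∫ x in Real.pi..(2 * Real.pi), (Real.sqrt (speedSq a (2 * a * (1 - δ ^ 2)) x))⁻¹ := by
        rw [intervalIntegral.integral_comp_add_left
          (fun x => (Real.sqrt (speedSq a (2 * a * (1 - δ ^ 2)) x))⁻¹)]
        congr 1 <;> ring
    _ ≤ wavePeriod a (2 * a * (1 - δ ^ 2)) := by
        unfold wavePeriod travelTime
        rw [← intervalIntegral.integral_add_adjacent_intervals
          (hcont.intervalIntegrable 0 Real.pi) (hcont.intervalIntegrable Real.pi (2 * Real.pi))]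
        have := intervalIntegral.integral_nonneg (μ := MeasureTheory.volume) hpi.le
          (f := fun x => (Real.sqrt (speedSq a (2 * a * (1 - δ ^ 2)) x))⁻¹)
          (fun x _ => by positivity)
        linarith

lemma exists_wavePeriod_eq {a L : ℝ} (ha : 0 < a) (hL : 2 * Real.pi / Real.sqrt a < L) :
    ∃ k, 0 < k ∧ k < 2 * a ∧ wavePeriod a k = L := by
  have hsa := Real.sqrt_pos.2 ha
  have hL0 : 0 < L := lt_trans (by positivity) hL
  -- Chosen so that the lower bound of `wavePeriod_lower` is exactly `L`.
  set δ := Real.exp (-(Real.sqrt a * L / 2)) with hδ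
  have hδ0 : 0 < δ := Real.exp_pos _
  have hδ1 : δ < 1 := by
    rw [hδ, Real.exp_lt_one_iff]
    have : 0 < Real.sqrt a * L / 2 := by positivity
    linarith
  have hlow := wavePeriod_lower hδ0 hδ1 ha
  have e : (Real.sqrt a)⁻¹ * (-2 * Real.log δ) = L := by
    rw [hδ, Real.log_exp]; field_simp
  rw [e] at hlow
  have h2 : 2 * a * (1 - δ ^ 2) < 2 * a := by nlinarith [mul_pos ha (pow_pos hδ0 2)]
  have h0 : 0 ≤ 2 * a * (1 - δ ^ 2) := by
    have : δ ^ 2 < 1 := by nlinarith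
    nlinarith
  rw [← wavePeriod_zero] at hL
  obtain ⟨k, hk, hkL⟩ := intermediate_value_Icc h0 (continuousOn_wavePeriod h2) ⟨hL.le, hlow⟩
  refine ⟨k, lt_of_le_of_ne hk.1 ?_, hk.2.trans_lt h2, hkL⟩
  rintro rfl
  exact hL.ne hkL

/-! ### Inverting the travel time: the phase and the wave. -/

lemma hasDerivAt_travelTime {a k : ℝ} (hk : 0 ≤ k) (hka : k < 2 * a) (θ : ℝ) :
    HasDerivAt (travelTime a k) (Real.sqrt (speedSq a k θ))⁻¹ θ :=
  intervalIntegral.integral_hasDerivAt_right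
    ((continuous_inv_speed hk hka).intervalIntegrable _ _)
    ((continuous_inv_speed hk hka).stronglyMeasurableAtFilter _ _)
    (continuous_inv_speed hk hka).continuousAt

lemma travelTime_strictMono {a k : ℝ} (hk : 0 ≤ k) (hka : k < 2 * a) :
    StrictMono (travelTime a k) := by
  apply strictMono_of_deriv_pos
  intro θ
  rw [(hasDerivAt_travelTime hk hka θ).deriv]
  exact inv_pos.2 (Real.sqrt_pos.2 (speedSq_pos hk hka θ))

lemma travelTime_zero (a k : ℝ) : travelTime a k 0 = 0 := by simp [travelTime]

lemma travelTime_add_two_pi {a k : ℝ} (hk : 0 ≤ k) (hka : k < 2 * a) (θ : ℝ) :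
    travelTime a k (θ + 2 * Real.pi) = travelTime a k θ + wavePeriod a k := by
  have hcont := continuous_inv_speed hk hka
  have hper : Function.Periodic (fun φ => (Real.sqrt (speedSq a k φ))⁻¹) (2 * Real.pi) := by
    intro φ; simp only [speedSq_periodic a k φ]
  have := hper.intervalIntegral_add_eq θ 0
  rw [zero_add] at this
  unfold wavePeriod travelTime
  rw [← this, intervalIntegral.integral_add_adjacent_intervals
    (hcont.intervalIntegrable _ _) (hcont.intervalIntegrable _ _)]

lemma wavePeriod_pos {a k : ℝ} (hk : 0 ≤ k) (hka : k < 2 * a) : 0 < wavePeriod a k := by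
  have := travelTime_strictMono hk hka (show (0 : ℝ) < 2 * Real.pi by positivity)
  rwa [travelTime_zero] at this

lemma travelTime_nat_mul {a k : ℝ} (hk : 0 ≤ k) (hka : k < 2 * a) (n : ℕ) :
    travelTime a k (n * (2 * Real.pi)) = n * wavePeriod a k := by
  induction n with
  | zero => simp [travelTime_zero]
  | succ n ih =>
    have := travelTime_add_two_pi hk hka (n * (2 * Real.pi))
    push_cast
    rw [add_mul, one_mul, this, ih]
    ring

lemma travelTime_surjective {a k : ℝ} (hk : 0 ≤ k) (hka : k < 2 * a) :
    Function.Surjective (travelTime a k) := by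
  have hT := wavePeriod_pos hk hka
  have hc : Continuous (travelTime a k) :=
    continuous_iff_continuousAt.2 fun θ => (hasDerivAt_travelTime hk hka θ).continuousAt
  have hmono := (travelTime_strictMono hk hka).monotone
  have hneg : ∀ n : ℕ, travelTime a k (-(n * (2 * Real.pi))) = -(n * wavePeriod a k) := by
    intro n
    induction n with
    | zero => simp [travelTime_zero]
    | succ n ih =>
      have := travelTime_add_two_pi hk hka (-((n + 1 : ℝ) * (2 * Real.pi)))
      rw [show -((n + 1 : ℝ) * (2 * Real.pi)) + 2 * Real.pi = -(n * (2 * Real.pi)) by ring,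
        ih] at this
      push_cast
      linarith
  refine hc.surjective ?_ ?_
  · apply Filter.tendsto_atTop_atTop_of_monotone hmono
    intro b
    obtain ⟨n, hn⟩ := exists_nat_ge (b / wavePeriod a k)
    exact ⟨_, ((div_le_iff₀ hT).1 hn).trans_eq (travelTime_nat_mul hk hka n).symm⟩
  · apply Filter.tendsto_atBot_atBot_of_monotone hmono
    intro b
    obtain ⟨n, hn⟩ := exists_nat_ge (-b / wavePeriod a k)
    refine ⟨_, (hneg n).trans_le ?_⟩
    have := (div_le_iff₀ hT).1 hn
    linarith

/-- The angle as a function of time. -/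
lemma exists_phase {a k : ℝ} (hk : 0 ≤ k) (hka : k < 2 * a) :
    ∃ θ : ℝ → ℝ, (∀ x, HasDerivAt θ (Real.sqrt (speedSq a k (θ x))) x) ∧
      ∀ x y, θ x = y ↔ x = travelTime a k y := by
  let e := (travelTime_strictMono hk hka).orderIsoOfSurjective _ (travelTime_surjective hk hka)
  have hte : ∀ x, travelTime a k (e.symm x) = x := fun x => e.apply_symm_apply x
  refine ⟨e.symm, fun x => ?_, fun x y => ?_⟩
  · have h := hasDerivAt_travelTime hk hka (e.symm x)
    have := h.of_local_left_inverse e.symm.toHomeomorph.continuous.continuousAt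
      (inv_ne_zero (Real.sqrt_pos.2 (speedSq_pos hk hka _)).ne') (Filter.Eventually.of_forall hte)
    rwa [inv_inv] at this
  · rw [e.symm_apply_eq]; rfl

lemma hasDerivAt_speed {a k : ℝ} (hk : 0 ≤ k) (hka : k < 2 * a) (θ : ℝ) :
    HasDerivAt (fun φ => Real.sqrt (speedSq a k φ))
      (-(k * (Real.sin θ / 2 * (2 - Real.cos θ)) / 6) / (2 * Real.sqrt (speedSq a k θ))) θ := by
  have h1 : HasDerivAt (fun φ => (1 - Real.cos φ) / 2) (Real.sin θ / 2) θ := by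
    simpa using ((Real.hasDerivAt_cos θ).const_sub 1).div_const 2
  have h2 : HasDerivAt (speedSq a k) (-(k * (Real.sin θ / 2 * (2 - Real.cos θ)) / 6)) θ := by
    convert! ((((h1.const_add 1).add (h1.pow 2)).const_mul k).div_const 6).const_sub a using 1
    push_cast; ring
  exact h2.sqrt (speedSq_pos hk hka θ).ne'

/-- The periodic wave of amplitude `r`. -/
lemma exists_wave {a r : ℝ} (hr : 0 < r) (hra : r ^ 2 < 2 * a) :
    ∃ u u' : ℝ → ℝ, (∀ x, HasDerivAt u (u' x) x) ∧
      (∀ x, HasDerivAt u' ((a * r - r ^ 3 / 6) / 2 - a * u x + u x ^ 3 / 3) x) ∧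
      u 0 = 0 ∧ u' 0 = 0 ∧ Function.Periodic u (wavePeriod a (r ^ 2)) ∧
      ∀ x, 0 < x → u x = 0 → ∃ n : ℕ, 0 < n ∧ x = n * wavePeriod a (r ^ 2) := by
  have hk : 0 ≤ r ^ 2 := sq_nonneg r
  obtain ⟨θ, hθ, hinv⟩ := exists_phase hk hra
  have h0 : θ 0 = 0 := (hinv _ _).2 (travelTime_zero _ _).symm
  have hper : ∀ x, θ (x + wavePeriod a (r ^ 2)) = θ x + 2 * Real.pi := fun x => by
    rw [hinv, travelTime_add_two_pi hk hra, ← (hinv x _).1 rfl]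
  refine ⟨fun x => r * ((1 - Real.cos (θ x)) / 2),
    fun x => r / 2 * (Real.sin (θ x) * Real.sqrt (speedSq a (r ^ 2) (θ x))), fun x => ?_,
    fun x => ?_, by simp [h0], by simp [h0], fun x => by simp [hper], fun x hx hux => ?_⟩
  · convert! ((((hθ x).cos).const_sub 1).div_const 2).const_mul r using 1
    ring
  · have hs : 0 < Real.sqrt (speedSq a (r ^ 2) (θ x)) := Real.sqrt_pos.2 (speedSq_pos hk hra _)
    have hsq := Real.sq_sqrt (speedSq_pos hk hra (θ x)).le
    have h1 := (hasDerivAt_speed hk hra (θ x)).comp x (hθ x)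
    convert! (((hθ x).sin).mul h1).const_mul (r / 2) using 1
    have hsin := Real.sin_sq_add_cos_sq (θ x)
    simp only [Function.comp]
    generalize Real.sqrt (speedSq a (r ^ 2) (θ x)) = g at hs hsq ⊢
    unfold speedSq at hsq
    generalize Real.sin (θ x) = s at hsin ⊢
    generalize Real.cos (θ x) = c at hsin hsq ⊢
    -- Once the division by the speed `g` is cleared, only `g²` and `s²` remain, and both are
    -- polynomials in the cosine.
    have e : c * g * g + s * (-(r ^ 2 * (s / 2 * (2 - c)) / 6) / (2 * g) * g) =
        c * g ^ 2 - s ^ 2 * r ^ 2 * (2 - c) / 24 := by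
      field_simp
      ring
    rw [e, hsq, show s ^ 2 = 1 - c ^ 2 by linarith]
    ring
  · have hcos : Real.cos (θ x) = 1 := by
      have : (1 - Real.cos (θ x)) / 2 = 0 := (mul_eq_zero.1 hux).resolve_left hr.ne'
      linarith
    -- Zeros of the wave are exactly the times when the phase is a multiple of `2π`.
    obtain ⟨n, hn⟩ := (Real.cos_eq_one_iff _).1 hcos
    have hθpos : 0 < θ x := by
      rw [← (travelTime_strictMono hk hra).lt_iff_lt, travelTime_zero, ← (hinv x _).1 rfl]
      exact hx
    have hnpos : 0 < n := by
      rw [← hn] at hθpos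
      exact_mod_cast pos_of_mul_pos_left hθpos (by positivity)
    lift n to ℕ using hnpos.le
    refine ⟨n, by exact_mod_cast hnpos, ?_⟩
    rw [← travelTime_nat_mul hk hra, ← hinv, ← hn]
    simp

/-! ### The integrated equation: regularity, uniqueness and energy. -/

/-- `v'' + a v - v³ / 3 = b` on `[0, L]`, with `v'` the derivative of `v`. -/
structure IsOscillation (a b L : ℝ) (v v' : ℝ → ℝ) : Prop where
  deriv : ∀ x ∈ Set.Icc 0 L, HasDerivWithinAt v (v' x) (Set.Icc 0 L) x
  deriv' : ∀ x ∈ Set.Icc 0 L,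
    HasDerivWithinAt v' (b - a * v x + v x ^ 3 / 3) (Set.Icc 0 L) x

lemma IsOscillation.mono {a b L M : ℝ} {v v' : ℝ → ℝ} (h : IsOscillation a b L v v')
    (hM : M ≤ L) : IsOscillation a b M v v' :=
  ⟨fun x hx => (h.deriv x (Set.Icc_subset_Icc_right hM hx)).mono (Set.Icc_subset_Icc_right hM),
    fun x hx => (h.deriv' x (Set.Icc_subset_Icc_right hM hx)).mono (Set.Icc_subset_Icc_right hM)⟩

lemma IsOscillation.neg {a b L : ℝ} {v v' : ℝ → ℝ} (h : IsOscillation a b L v v') :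
    IsOscillation a (-b) L (-v) (-v') := by
  refine ⟨fun x hx => (h.deriv x hx).neg, fun x hx => ?_⟩
  convert! (h.deriv' x hx).neg using 1
  simp; ring

lemma IsOscillation.congr {a b L : ℝ} {u v v' : ℝ → ℝ} (h : IsOscillation a b L v v')
    (huv : Set.EqOn u v (Set.Icc 0 L)) : IsOscillation a b L u v' := by
  refine ⟨fun x hx => (h.deriv x hx).congr huv (huv hx), fun x hx => ?_⟩
  rw [huv hx]
  exact h.deriv' x hx

/-- The third-order equation says that `v'' + a v - v³/3` has zero derivative; `b` is its constant
value. Conversely, the second-order equation bootstraps the regularity. -/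
lemma isStationarySolution_iff {a L : ℝ} (hL : 0 < L) {v : ℝ → ℝ} :
    IsStationarySolution a L v ↔
      ∃ v' b, IsOscillation a b L v v' ∧ v 0 = 0 ∧ v L = 0 ∧ v' L = 0 := by
  have hu := uniqueDiffOn_Icc hL
  set I := Set.Icc 0 L with hI
  have h3 : ∀ x, iteratedDerivWithin 3 v I x =
      derivWithin (derivWithin (derivWithin v I) I) I x := fun x => by
    rw [iteratedDerivWithin_eq_iterate]; rfl
  constructor
  · intro h
    have c1 : ContDiffOn ℝ 2 (derivWithin v I) I := h.contDiffOn.derivWithin hu (by norm_num)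
    have c2 : ContDiffOn ℝ 1 (derivWithin (derivWithin v I) I) I :=
      c1.derivWithin hu (by norm_num)
    have d0 : ∀ x ∈ I, HasDerivWithinAt v (derivWithin v I x) I x := fun x hx =>
      (h.contDiffOn.differentiableOn (by norm_num) x hx).hasDerivWithinAt
    have d1 := fun x (hx : x ∈ I) => (c1.differentiableOn (by norm_num) x hx).hasDerivWithinAt
    have d2 := fun x (hx : x ∈ I) => (c2.differentiableOn (by norm_num) x hx).hasDerivWithinAt
    have dG : ∀ x ∈ I, HasDerivWithinAt (fun y => derivWithin (derivWithin v I) I y + a * v y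
        - v y ^ 3 / 3) 0 I x := fun x hx => by
      convert! ((d2 x hx).add ((d0 x hx).const_mul a)).sub (((d0 x hx).pow 3).div_const 3) using 1
      rw [← h3, ← h.equation x hx]
      simp; ring
    obtain ⟨b, hb⟩ : ∃ b, ∀ x ∈ I, derivWithin (derivWithin v I) I x + a * v x - v x ^ 3 / 3 = b :=
      ⟨_, constant_of_derivWithin_zero (fun x hx => (dG x hx).differentiableWithinAt)
      (fun x hx => (dG x (Set.Ico_subset_Icc_self hx)).derivWithin
        (hu x (Set.Ico_subset_Icc_self hx)))⟩
    refine ⟨derivWithin v I, b, ⟨d0, fun x hx => ?_⟩, h.left_value, h.right_value, h.right_deriv⟩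
    rw [← hb x hx]
    convert! d1 x hx using 1
    ring
  · rintro ⟨v', b, h, h0, hLv, hLv'⟩
    have e1 : ∀ x ∈ I, derivWithin v I x = v' x := fun x hx => (h.deriv x hx).derivWithin (hu x hx)
    have e2 : ∀ x ∈ I, derivWithin v' I x = b - a * v x + v x ^ 3 / 3 := fun x hx =>
      (h.deriv' x hx).derivWithin (hu x hx)
    have e2' : ∀ x ∈ I, derivWithin (derivWithin v I) I x = b - a * v x + v x ^ 3 / 3 :=
      fun x hx => by rw [derivWithin_congr e1 (e1 x hx), e2 x hx]
    have step : ∀ (n : ℕ) (f f' : ℝ → ℝ), (∀ x ∈ I, HasDerivWithinAt f (f' x) I x) →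
        ContDiffOn ℝ n f' I → ContDiffOn ℝ (n + 1) f I := fun n f f' hf hf' => by
      rw [contDiffOn_succ_iff_derivWithin hu]
      exact ⟨fun x hx => (hf x hx).differentiableWithinAt, by simp,
        hf'.congr fun x hx => (hf x hx).derivWithin (hu x hx)⟩
    -- Bootstrap: `v'` continuous makes `v` of class `C¹`, so `v'` is `C²`, so `v` is `C³`.
    have hcv' : ContinuousOn v' I := fun x hx => (h.deriv' x hx).continuousWithinAt
    have s1 : ContDiffOn ℝ 1 v I := by
      simpa using step 0 v v' h.deriv (by simpa [contDiffOn_zero] using hcv')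
    have s2 : ContDiffOn ℝ 2 v' I := by
      have := step 1 v' _ h.deriv' (by
        exact (contDiffOn_const.sub (contDiffOn_const.mul s1)).add ((s1.pow 3).div_const 3))
      exact this.of_le (by norm_num)
    have s3 : ContDiffOn ℝ 3 v I := (step 2 v v' h.deriv s2).of_le (by norm_num)
    refine ⟨s3, fun x hx => ?_, h0, hLv, ?_⟩
    · have hd : HasDerivWithinAt (fun y => b - a * v y + v y ^ 3 / 3)
          (-(a * v' x) + v x ^ 2 * v' x) I x := by
        convert! (((h.deriv x hx).const_mul a).const_sub b).add
          (((h.deriv x hx).pow 3).div_const 3) using 1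
        simp; ring
      rw [← hI, h3, derivWithin_congr e2' (e2' x hx), hd.derivWithin (hu x hx), e1 x hx]
      ring
    · exact (e1 L ⟨hL.le, le_rfl⟩).trans hLv'

/-- The vector field of the first-order system equivalent to `v'' = b - a v + v³ / 3`. -/
lemma exists_lipschitzOnWith_field (a b R : ℝ) :
    ∃ K, LipschitzOnWith K (fun p : ℝ × ℝ => (p.2, b - a * p.1 + p.1 ^ 3 / 3))
      (Metric.closedBall 0 R) :=
  ContDiffOn.exists_lipschitzOnWith (n := 1) (by fun_prop) one_ne_zero
    (convex_closedBall 0 R) (isCompact_closedBall 0 R)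

lemma IsOscillation.continuousOn {a b L : ℝ} {v v' : ℝ → ℝ} (h : IsOscillation a b L v v') :
    ContinuousOn (fun x => (v x, v' x)) (Set.Icc 0 L) :=
  ContinuousOn.prodMk (fun x hx => (h.deriv x hx).continuousWithinAt)
    (fun x hx => (h.deriv' x hx).continuousWithinAt)

lemma IsOscillation.exists_bound {a b L : ℝ} {v v' : ℝ → ℝ} (h : IsOscillation a b L v v') :
    ∃ R, ∀ x ∈ Set.Icc 0 L, (v x, v' x) ∈ Metric.closedBall (0 : ℝ × ℝ) R := by
  obtain ⟨R, hR⟩ := isCompact_Icc.exists_bound_of_continuousOn h.continuousOn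
  exact ⟨R, fun x hx => by simpa [mem_closedBall_zero_iff] using hR x hx⟩

/-- The field is only locally Lipschitz, but on a compact interval both trajectories stay in one
ball. -/
lemma IsOscillation.eqOn_of_left {a b L : ℝ} {u u' v v' : ℝ → ℝ}
    (hu : IsOscillation a b L u u') (hv : IsOscillation a b L v v')
    (h0 : u 0 = v 0) (h0' : u' 0 = v' 0) : Set.EqOn u v (Set.Icc 0 L) := by
  obtain ⟨R, hR⟩ := hu.exists_bound
  obtain ⟨S, hS⟩ := hv.exists_bound
  obtain ⟨K, hK⟩ := exists_lipschitzOnWith_field a b (max R S)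
  have hd : ∀ {w w' : ℝ → ℝ}, IsOscillation a b L w w' → ∀ t ∈ Set.Ico 0 L,
      HasDerivWithinAt (fun x => (w x, w' x)) (w' t, b - a * w t + w t ^ 3 / 3) (Set.Ici t) t :=
    fun hw t ht => by
      have ht' := Set.Ico_subset_Icc_self ht
      exact ((hw.deriv t ht').prodMk (hw.deriv' t ht')).mono_of_mem_nhdsWithin
        (Icc_mem_nhdsGE_of_mem ht)
  have := ODE_solution_unique_of_mem_Icc_right (fun _ _ => hK) hu.continuousOn (hd hu)
    (fun t ht => Metric.closedBall_subset_closedBall (le_max_left R S)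
      (hR t (Set.Ico_subset_Icc_self ht))) hv.continuousOn (hd hv)
    (fun t ht => Metric.closedBall_subset_closedBall (le_max_right R S)
      (hS t (Set.Ico_subset_Icc_self ht))) (by simp [h0, h0'])
  exact fun x hx => (Prod.ext_iff.1 (this hx)).1

/-- Backward uniqueness serves to compare a solution with an equilibrium from its maximum point back
to `0`. -/
lemma IsOscillation.eqOn_of_right {a b L : ℝ} {u u' v v' : ℝ → ℝ}
    (hu : IsOscillation a b L u u') (hv : IsOscillation a b L v v')
    (h0 : u L = v L) (h0' : u' L = v' L) : Set.EqOn u v (Set.Icc 0 L) := by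
  obtain ⟨R, hR⟩ := hu.exists_bound
  obtain ⟨S, hS⟩ := hv.exists_bound
  obtain ⟨K, hK⟩ := exists_lipschitzOnWith_field a b (max R S)
  have hd : ∀ {w w' : ℝ → ℝ}, IsOscillation a b L w w' → ∀ t ∈ Set.Ioc 0 L,
      HasDerivWithinAt (fun x => (w x, w' x)) (w' t, b - a * w t + w t ^ 3 / 3) (Set.Iic t) t :=
    fun hw t ht => by
      have ht' := Set.Ioc_subset_Icc_self ht
      exact ((hw.deriv t ht').prodMk (hw.deriv' t ht')).mono_of_mem_nhdsWithin
        (Icc_mem_nhdsLE_of_mem ht)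
  have := ODE_solution_unique_of_mem_Icc_left (fun _ _ => hK) hu.continuousOn (hd hu)
    (fun t ht => Metric.closedBall_subset_closedBall (le_max_left R S)
      (hR t (Set.Ioc_subset_Icc_self ht))) hv.continuousOn (hd hv)
    (fun t ht => Metric.closedBall_subset_closedBall (le_max_right R S)
      (hS t (Set.Ioc_subset_Icc_self ht))) (by simp [h0, h0'])
  exact fun x hx => (Prod.ext_iff.1 (this hx)).1

/-- Multiplying the equation by `2v'` gives a first integral; the data at `L` make its constant
zero. -/
lemma IsOscillation.energy {a b L : ℝ} {v v' : ℝ → ℝ} (h : IsOscillation a b L v v')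
    (hL : 0 < L) (hv : v L = 0) (hv' : v' L = 0) :
    ∀ x ∈ Set.Icc 0 L, v' x ^ 2 = v x * (2 * b - a * v x + v x ^ 3 / 6) := by
  have hd : ∀ x ∈ Set.Icc 0 L, HasDerivWithinAt
      (fun y => v' y ^ 2 - v y * (2 * b - a * v y + v y ^ 3 / 6)) 0 (Set.Icc 0 L) x := by
    intro x hx
    have d := h.deriv x hx
    convert! ((h.deriv' x hx).pow 2).sub
      (d.mul (((d.const_mul a).const_sub (2 * b)).add ((d.pow 3).div_const 6))) using 1
    simp; ring
  have hc := constant_of_derivWithin_zero (fun x hx => (hd x hx).differentiableWithinAt)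
      (fun x hx => (hd x (Set.Ico_subset_Icc_self hx)).derivWithin
        (uniqueDiffOn_Icc hL x (Set.Ico_subset_Icc_self hx)))
  have hLL := hc L ⟨hL.le, le_rfl⟩
  intro x hx
  have hx := hc x hx
  rw [← hLL, hv, hv'] at hx
  linarith

/-- A solution with `b > 0` touching zero at both endpoints with zero slope oscillates between
`0` and an amplitude `r` with `r² < 2a`. -/
lemma IsOscillation.exists_amplitude {a b L : ℝ} {v v' : ℝ → ℝ} (h : IsOscillation a b L v v')
    (hL : 0 < L) (hb : 0 < b) (h0 : v 0 = 0) (hvL : v L = 0) (hvL' : v' L = 0) :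
    ∃ r, 0 < r ∧ r ^ 2 < 2 * a ∧ b = (a * r - r ^ 3 / 6) / 2 := by
  have hE := h.energy hL hvL hvL'
  have hcv : ContinuousOn v (Set.Icc 0 L) := fun x hx => (h.deriv x hx).continuousWithinAt
  have m0 : (0 : ℝ) ∈ Set.Icc 0 L := ⟨le_rfl, hL.le⟩
  have hv0' : v' 0 = 0 := by
    have := hE 0 m0
    rw [h0, zero_mul] at this
    exact pow_eq_zero_iff (two_ne_zero) |>.1 this
  obtain ⟨x₀, hx₀, hmax⟩ := isCompact_Icc.exists_isMaxOn ⟨0, m0⟩ hcv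
  set r := v x₀ with hr
  have hr0 : 0 < r := by
    by_contra hneg
    have hle : ∀ x ∈ Set.Icc 0 L, v x ≤ 0 := fun x hx => (hmax hx).trans (not_lt.1 hneg)
    -- `v ≤ 0` and `v'² = v (2b + o(1))` force `v = 0` near `0`, contradicting `v'' (0) = b`.
    have hc : ContinuousWithinAt (fun x => 2 * b - a * v x + v x ^ 3 / 6) (Set.Icc 0 L) 0 := by
      have := hcv 0 m0
      fun_prop
    have hev : ∀ᶠ x in nhdsWithin 0 (Set.Icc 0 L), 0 < 2 * b - a * v x + v x ^ 3 / 6 :=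
      hc.eventually_const_lt (by simp [h0, hb])
    have hz : ∀ᶠ x in nhdsWithin 0 (Set.Icc 0 L), v' x = 0 := by
      filter_upwards [hev, self_mem_nhdsWithin] with x hx hxI
      have := hE x hxI
      have h1 := mul_nonpos_of_nonpos_of_nonneg (hle x hxI) hx.le
      exact pow_eq_zero_iff two_ne_zero |>.1 (le_antisymm (this ▸ h1) (sq_nonneg _))
    have d1 := h.deriv' 0 m0
    have d2 : HasDerivWithinAt v' 0 (Set.Icc 0 L) 0 :=
      (hasDerivWithinAt_const (0 : ℝ) (Set.Icc 0 L) (0 : ℝ)).congr_of_eventuallyEq hz hv0'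
    have := (uniqueDiffOn_Icc hL 0 m0).eq_deriv _ d1 d2
    rw [h0] at this
    simp at this
    exact hb.ne' this
  have hx0pos : 0 < x₀ := lt_of_le_of_ne hx₀.1 (by rintro rfl; exact hr0.ne' h0)
  have hx0lt : x₀ < L := lt_of_le_of_ne hx₀.2 (by rintro rfl; exact hr0.ne' hvL)
  have hx0' : v' x₀ = 0 := by
    have hn := Icc_mem_nhds hx0pos hx0lt
    exact (hmax.isLocalMax hn).hasDerivAt_eq_zero ((h.deriv x₀ hx₀).hasDerivAt hn)
  have hbr : b = (a * r - r ^ 3 / 6) / 2 := by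
    have := hE x₀ hx₀
    rw [hx0', ← hr] at this
    have h2 : r * (2 * b - a * r + r ^ 3 / 6) = 0 := by linarith
    have := (mul_eq_zero.1 h2).resolve_left hr0.ne'
    linarith
  refine ⟨r, hr0, ?_, hbr⟩
  by_contra hge
  rcases (not_lt.1 hge).lt_or_eq with hlt | heq
  · -- just below `r` the energy would be negative
    have hc : ContinuousAt (fun y : ℝ => a - (r ^ 2 + r * y + y ^ 2) / 6) r := by fun_prop
    have hev : ∀ᶠ y in nhds r, a - (r ^ 2 + r * y + y ^ 2) / 6 < 0 :=
      hc.eventually_lt_const (by nlinarith)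
    obtain ⟨y, hy, hyr⟩ := (((hev.filter_mono nhdsWithin_le_nhds).and
      (Ioo_mem_nhdsLT hr0)).exists : ∃ y, _ ∧ y ∈ Set.Ioo 0 r)
    have hsub : Set.Icc 0 x₀ ⊆ Set.Icc 0 L := Set.Icc_subset_Icc_right hx₀.2
    obtain ⟨x, hx, hxy⟩ := intermediate_value_Icc hx₀.1 (hcv.mono hsub)
      (show y ∈ Set.Icc (v 0) (v x₀) from ⟨h0.trans_le hyr.1.le, hyr.2.le⟩)
    have := hE x (hsub hx)
    rw [hxy, hbr] at this
    have e : y * (2 * ((a * r - r ^ 3 / 6) / 2) - a * y + y ^ 3 / 6) =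
        y * (r - y) * (a - (r ^ 2 + r * y + y ^ 2) / 6) := by ring
    rw [e] at this
    have := mul_neg_of_pos_of_neg (mul_pos hyr.1 (sub_pos.2 hyr.2)) hy
    nlinarith [sq_nonneg (v' x)]
  · -- `r` would be an equilibrium
    have hconst : IsOscillation a b x₀ (fun _ => r) (fun _ => 0) := by
      refine ⟨fun x _ => hasDerivWithinAt_const _ _ _, fun x _ => ?_⟩
      convert! hasDerivWithinAt_const x (Set.Icc 0 x₀) (0 : ℝ) using 1
      rw [hbr, show a = r ^ 2 / 2 by linarith]
      ring
    have := (h.mono hx₀.2).eqOn_of_right hconst hr.symm hx0' ⟨le_rfl, hx₀.1⟩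
    rw [h0] at this
    exact hr0.ne this

/-! ### Periodic extension and classification of the solutions. -/

lemma mul_fract_div_mem {L : ℝ} (hL : 0 < L) (x : ℝ) :
    L * Int.fract (x / L) ∈ Set.Icc 0 L :=
  ⟨mul_nonneg hL.le (Int.fract_nonneg _), mul_le_of_le_one_right hL.le (Int.fract_lt_one _).le⟩

lemma periodicExtension_congr {L : ℝ} (hL : 0 < L) {u v : ℝ → ℝ}
    (h : Set.EqOn u v (Set.Icc 0 L)) : periodicExtension L u = periodicExtension L v :=
  funext fun x => h (mul_fract_div_mem hL x)

lemma periodicExtension_of_periodic {L : ℝ} (hL : 0 < L) {u : ℝ → ℝ}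
    (h : Function.Periodic u L) : periodicExtension L u = u := by
  funext x
  have : L * Int.fract (x / L) = x - ⌊x / L⌋ * L := by
    rw [← Int.self_sub_floor, mul_sub, mul_div_cancel₀ _ hL.ne', mul_comm L]
  rw [periodicExtension, this, h.sub_int_mul_eq]

lemma IsNontrivialSolutionWithPeriod.congr {a L : ℝ} (hL : 0 < L) {u v : ℝ → ℝ}
    (h : IsNontrivialSolutionWithPeriod a L L u) (hvu : Set.EqOn v u (Set.Icc 0 L)) :
    IsNontrivialSolutionWithPeriod a L L v := by
  refine ⟨?_, ?_, ?_⟩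
  · obtain ⟨u', b, ho, h0, h1, h2⟩ := (isStationarySolution_iff hL).1 h.solution
    exact (isStationarySolution_iff hL).2 ⟨u', b, ho.congr hvu,
      (hvu ⟨le_rfl, hL.le⟩).trans h0, (hvu ⟨hL.le, le_rfl⟩).trans h1, h2⟩
  · obtain ⟨x, hx, hne⟩ := h.nontrivial
    exact ⟨x, hx, by rwa [hvu hx]⟩
  · rw [periodicExtension_congr hL hvu]
    exact h.fundamentalPeriod

lemma IsNontrivialSolutionWithPeriod.neg {a L : ℝ} (hL : 0 < L) {u : ℝ → ℝ}
    (h : IsNontrivialSolutionWithPeriod a L L u) :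
    IsNontrivialSolutionWithPeriod a L L (-u) := by
  refine ⟨?_, ?_, ?_⟩
  · obtain ⟨u', b, ho, h0, h1, h2⟩ := (isStationarySolution_iff hL).1 h.solution
    exact (isStationarySolution_iff hL).2 ⟨-u', -b, ho.neg, by simp [h0], by simp [h1],
      by simp [h2]⟩
  · obtain ⟨x, hx, hne⟩ := h.nontrivial
    exact ⟨x, hx, by simpa using hne⟩
  · have : ∀ S, Function.Periodic (periodicExtension L (-u)) S ↔
        Function.Periodic (periodicExtension L u) S := fun S => by
      simp [Function.Periodic, periodicExtension]
    simpa only [IsFundamentalPeriod, this] using h.fundamentalPeriod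

/-- The wave whose period is `L` solves the boundary value problem. -/
lemma isNontrivialSolution_of_wave {a r L : ℝ} {u u' : ℝ → ℝ} (hL : 0 < L)
    (hu : ∀ x, HasDerivAt u (u' x) x)
    (hu' : ∀ x, HasDerivAt u' ((a * r - r ^ 3 / 6) / 2 - a * u x + u x ^ 3 / 3) x)
    (h0 : u 0 = 0) (h0' : u' 0 = 0) (hper : Function.Periodic u L)
    (hzero : ∀ x, 0 < x → u x = 0 → ∃ n : ℕ, 0 < n ∧ x = n * L) :
    IsNontrivialSolutionWithPeriod a L L u := by
  have huL : u L = 0 := by simpa [h0] using hper 0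
  have hle : ∀ x, 0 < x → u x = 0 → L ≤ x := fun x hx hux => by
    obtain ⟨n, hn, rfl⟩ := hzero x hx hux
    have : (1 : ℝ) ≤ n := by exact_mod_cast hn
    nlinarith
  refine ⟨(isStationarySolution_iff hL).2 ⟨u', _, ⟨fun x _ => (hu x).hasDerivWithinAt,
    fun x _ => (hu' x).hasDerivWithinAt⟩, h0, huL, ?_⟩, ⟨L / 2, ⟨by linarith, by linarith⟩, ?_⟩, ?_⟩
  -- Periodicity carries the zero slope from `0` to `L`.
  · have h1 := (hu (0 + L)).comp_add_const 0 L
    rw [show (fun x => u (x + L)) = u from funext hper] at h1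
    simpa [h0'] using h1.unique (hu 0)
  · intro h
    have := hle (L / 2) (by linarith) h
    linarith
  · rw [periodicExtension_of_periodic hL hper]
    refine ⟨⟨hL, hper⟩, fun S hS => hle S hS.1 ?_⟩
    simpa [h0] using hS.2 0

/-- A solution with fundamental period `L` is, up to sign, an oscillation starting at rest from `0` whose
amplitude `r` has wave period `L`. -/
lemma IsNontrivialSolutionWithPeriod.exists_amplitude {a L : ℝ} (hL : 0 < L) {v : ℝ → ℝ}
    (h : IsNontrivialSolutionWithPeriod a L L v) :
    ∃ r, 0 < r ∧ r ^ 2 < 2 * a ∧ wavePeriod a (r ^ 2) = L ∧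
      ∃ w w', (Set.EqOn v w (Set.Icc 0 L) ∨ Set.EqOn v (-w) (Set.Icc 0 L)) ∧ w 0 = 0 ∧ w' 0 = 0 ∧
        IsOscillation a ((a * r - r ^ 3 / 6) / 2) L w w' := by
  -- The case `b > 0` is the essential one: `b < 0` reduces to it by negation, and `b = 0`
  -- contradicts nontriviality.
  have main : ∀ (v v' : ℝ → ℝ) (b : ℝ), 0 < b → IsNontrivialSolutionWithPeriod a L L v →
      IsOscillation a b L v v' → v 0 = 0 → v L = 0 → v' L = 0 → v' 0 = 0 →
      ∃ r, 0 < r ∧ r ^ 2 < 2 * a ∧ wavePeriod a (r ^ 2) = L ∧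
        b = (a * r - r ^ 3 / 6) / 2 := by
    intro v v' b hb hv ho h0 h1 h2 h0'
    obtain ⟨r, hr, hra, rfl⟩ := ho.exists_amplitude hL hb h0 h1 h2
    refine ⟨r, hr, hra, ?_, rfl⟩
    obtain ⟨u, u', hu, hu', hu0, hu0', hper, hzero⟩ := exists_wave hr hra
    have hT := wavePeriod_pos (sq_nonneg r) hra
    have hou : IsOscillation a ((a * r - r ^ 3 / 6) / 2) L u u' :=
      ⟨fun x _ => (hu x).hasDerivWithinAt, fun x _ => (hu' x).hasDerivWithinAt⟩
    have heq := ho.eqOn_of_left hou (h0.trans hu0.symm) (h0'.trans hu0'.symm)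
    have huL : u L = 0 := (heq ⟨hL.le, le_rfl⟩).symm.trans h1
    -- `L` is a multiple `n T` of the wave period `T`, and minimality of `L` gives `L ≤ T`, so `L =
    -- T`.
    obtain ⟨n, hn, hnL⟩ := hzero L hL huL
    have hperL : Function.Periodic u L := hnL ▸ hper.nat_mul n
    have hfund := hv.fundamentalPeriod
    rw [periodicExtension_congr hL heq, periodicExtension_of_periodic hL hperL] at hfund
    have hle := hfund.2 ⟨hT, hper⟩
    have : (1 : ℝ) ≤ n := by exact_mod_cast hn
    nlinarith
  obtain ⟨v', b, ho, h0, h1, h2⟩ := (isStationarySolution_iff hL).1 h.solution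
  have h0' : v' 0 = 0 := by
    have := ho.energy hL h1 h2 0 ⟨le_rfl, hL.le⟩
    rw [h0, zero_mul] at this
    exact pow_eq_zero_iff (two_ne_zero) |>.1 this
  rcases lt_trichotomy b 0 with hb | rfl | hb
  · obtain ⟨r, hr, hra, hT, hbr⟩ := main (-v) (-v') (-b) (by linarith) (h.neg hL) ho.neg
      (by simp [h0]) (by simp [h1]) (by simp [h2]) (by simp [h0'])
    exact ⟨r, hr, hra, hT, -v, -v', Or.inr (by simp [Set.EqOn]), by simp [h0], by simp [h0'],
      hbr ▸ ho.neg⟩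
  · have hz : IsOscillation a 0 L (fun _ => 0) (fun _ => 0) :=
      ⟨fun x _ => hasDerivWithinAt_const _ _ _,
        fun x _ => by simpa using hasDerivWithinAt_const x (Set.Icc 0 L) (0 : ℝ)⟩
    obtain ⟨x, hx, hne⟩ := h.nontrivial
    exact absurd (ho.eqOn_of_left hz h0 h0' hx) hne
  · obtain ⟨r, hr, hra, hT, hbr⟩ := main v v' b hb h ho h0 h1 h2 h0'
    exact ⟨r, hr, hra, hT, v, v', Or.inl fun _ _ => rfl, h0, h0', hbr ▸ ho⟩

/-! ### The threshold `a L² = 4π²`. -/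

theorem theorem3 (a L : ℝ) (hL : 0 < L) :
    (4 * Real.pi ^ 2 < a * L ^ 2 →
      ∃ u : ℝ → ℝ, IsNontrivialSolutionWithPeriod a L L u ∧
        ∀ v : ℝ → ℝ, IsNontrivialSolutionWithPeriod a L L v ↔
          (Set.EqOn v u (Set.Icc 0 L) ∨ Set.EqOn v (-u) (Set.Icc 0 L))) ∧
    (a * L ^ 2 ≤ 4 * Real.pi ^ 2 →
      ¬ ∃ u : ℝ → ℝ, IsNontrivialSolutionWithPeriod a L L u) := by
  have hpi := Real.pi_pos
  constructor
  · intro h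
    have ha : 0 < a := by
      by_contra hneg
      nlinarith [mul_nonneg (neg_nonneg.2 (not_lt.1 hneg)) (sq_nonneg L), pow_pos hpi 2]
    have hsa := Real.sqrt_pos.2 ha
    have hLa : 2 * Real.pi / Real.sqrt a < L := by
      rw [div_lt_iff₀ hsa]
      apply lt_of_pow_lt_pow_left₀ 2 (by positivity)
      rw [mul_pow L, Real.sq_sqrt ha.le]
      linarith
    obtain ⟨k, hk, hka, hkL⟩ := exists_wavePeriod_eq ha hLa
    have hr := Real.sqrt_pos.2 hk
    have hrk := Real.sq_sqrt hk.le
    set r := Real.sqrt k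
    obtain ⟨u, u', hu, hu', hu0, hu0', hper, hzero⟩ := exists_wave hr (hrk.symm ▸ hka)
    rw [hrk, hkL] at hper hzero
    have hsol := isNontrivialSolution_of_wave hL hu hu' hu0 hu0' hper hzero
    refine ⟨u, hsol, fun v => ⟨fun hv => ?_, ?_⟩⟩
    · obtain ⟨s, hs, hsa, hsL, w, w', hvw, hw0, hw0', how⟩ := hv.exists_amplitude hL
      have hsk : s ^ 2 = r ^ 2 := by
        rw [hrk]
        exact wavePeriod_injOn a ⟨sq_nonneg s, hsa⟩ ⟨hk.le, hka⟩ (hsL.trans hkL.symm)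
      obtain rfl : s = r := (pow_left_inj₀ hs.le hr.le two_ne_zero).1 hsk
      have hwu := how.eqOn_of_left
        ⟨fun x _ => (hu x).hasDerivWithinAt, fun x _ => (hu' x).hasDerivWithinAt⟩
        (hw0.trans hu0.symm) (hw0'.trans hu0'.symm)
      exact hvw.imp (fun e => e.trans hwu) (fun e x hx => by rw [e hx, Pi.neg_apply, hwu hx,
        Pi.neg_apply])
    · rintro (hv | hv)
      · exact hsol.congr hL hv
      · exact (hsol.neg hL).congr hL hv
  · rintro h ⟨v, hv⟩
    obtain ⟨r, hr, hra, hrL, -⟩ := hv.exists_amplitude hL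
    have hr2 : 0 < r ^ 2 := pow_pos hr 2
    have ha : 0 < a := by linarith
    -- Comparison with zero amplitude: the period `L` strictly exceeds `2π/√a`.
    have hlt := wavePeriod_lt le_rfl hr2 hra
    rw [hrL, wavePeriod_zero, div_lt_iff₀ (Real.sqrt_pos.2 ha)] at hlt
    have := pow_lt_pow_left₀ hlt (by positivity) two_ne_zero
    rw [mul_pow L, Real.sq_sqrt ha.le] at this
    nlinarith
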